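/- Let $\Omega\subset\mathbb R^3$ be a compact set with smooth boundary $\partial\Omega$, $n$ the unit normal on $\partial\Omega$ pointing into the exterior $\Omega'=\mathbb R^3\setminus\Omega$, $dS$ the surface measure, and $k>0$. Write $\|\cdot\|$ for the norm of $L_2(\partial\Omega,dS)$. A radiating field is a function $u\in C^2(\Omega')$ that belongs to $H^1(\Omega'\cap B_R)$ for every $R$ ($B_R$ being the ball of radius $R$ about the origin), has trace $u|_{\partial\Omega}\in L_2(\partial\Omega)$ and (variational) normal derivative $\partial u/\partial n\in L_2(\partial\Omega)$, and satisfies $$\Delta u+k^2u=0\ \text{ in }\Omega',\qquad \int_{|r|=R}\Big|\frac{\partial u}{\partial |r|}-iku\Big|^2dS\to0\quad(R\to\infty).$$ Its scattering amplitude $u_\infty$ is the function on the unit sphere $S^2$ defined by $$u(r)=\frac{e^{ik|r|}}{|r|}\,u_\infty(\theta)+o\Big(\frac1{|r|}\Big),\qquad r\to\infty,\quad \theta=r/|r|.$$ Let $\gamma,f\in C(\partial\Omega)$ be complex-valued with $\Im\gamma(r)\ge\gamma_0>0$ on $\partial\Omega$ for a constant $\gamma_0$, let $\Gamma=\max_{\partial\Omega}|\gamma|$,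 and let $\alpha\in L_2(\partial\Omega,dS)$. Let $u^\gamma$ and $u^{\gamma,1}$ be radiating fields with $$\Big(\frac{\partial}{\partial n}+\gamma\Big)u^\gamma=f,\qquad \Big(\frac{\partial}{\partial n}+\gamma\Big)u^{\gamma,1}=f+\alpha\qquad\text{on }\partial\Omega .$$ Then 1. $\displaystyle \|u^\gamma-u^{\gamma,1}\|\le\frac1{\gamma_0}\|\alpha\|$; 2. $\displaystyle \Big\|\frac{\partial u^\gamma}{\partial n}-\frac{\partial u^{\gamma,1}}{\partial n}\Big\|\le\Big(\frac{\Gamma}{\gamma_0}+1\Big)\|\alpha\|$; 3. the scattering amplitudes satisfy $\displaystyle \|u^\gamma_\infty-u^{\gamma,1}_\infty\|^2_{L_2(S^2)}\le\frac1{k\gamma_0}\Big(\frac{\Gamma}{\gamma_0}+1\Big)\|\alpha\|^2 .$ -/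

import Mathlib

open MeasureTheory Filter Topology Metric Set
open scoped ContDiff InnerProductSpace ENNReal Laplacian

noncomputable section

/-- Euclidean three-space. -/
abbrev E3 : Type := EuclideanSpace ℝ (Fin 3)

/-- The unit sphere `S²`. -/
abbrev S2 : Type := sphere (0 : E3) 1

/-- The standard area measure of the unit sphere (of total mass `4π`). -/
abbrev areaS2 : Measure S2 := (volume : Measure E3).toSphere

/-- A bounded body with smooth boundary in `ℝ³`: a compact set which near each of its boundary
points is a sublevel set `{ρ ≤ 0}` of a smooth function with non-vanishing differential. -/
structure SmoothBody where
  carrier : Set E3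
  isCompact_carrier : IsCompact carrier
  smooth_boundary : ∀ x ∈ frontier carrier, ∃ U : Set E3, IsOpen U ∧ x ∈ U ∧
    ∃ ρ : E3 → ℝ, ContDiff ℝ ∞ ρ ∧ fderiv ℝ ρ x ≠ 0 ∧
      carrier ∩ U = {y ∈ U | ρ y ≤ 0}

namespace SmoothBody

/-- The exterior domain `ℝ³ \ Ω`. -/
def exterior (Ω : SmoothBody) : Set E3 := Ω.carrierᶜ

/-- The boundary `∂Ω`, as a type. -/
abbrev Boundary (Ω : SmoothBody) : Type := frontier Ω.carrier

instance instCompactSpaceBoundary (Ω : SmoothBody) : CompactSpace Ω.Boundary :=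
  isCompact_iff_compactSpace.mp
    (Ω.isCompact_carrier.of_isClosed_subset isClosed_frontier
      Ω.isCompact_carrier.isClosed.frontier_subset)

/-- The surface measure `dS` on `∂Ω`: the two-dimensional Hausdorff measure, normalised so that it
agrees with Lebesgue measure on planes. -/
abbrev surfaceMeasure (Ω : SmoothBody) : Measure Ω.Boundary := μHE[2]

/-- The space `L₂(∂Ω, dS)` of complex-valued functions. -/
abbrev L2Boundary (Ω : SmoothBody) : Type := Lp ℂ 2 Ω.surfaceMeasure

end SmoothBody

/-- `u₀` is the trace on `∂Ω` of the function `u`, which is given in the exterior domain. The trace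
operator is the closure of the restriction map of smooth functions: there are smooth `v j` on `ℝ³`
which converge to `u` in `H¹` of every bounded part of the exterior domain and whose restrictions to
`∂Ω` converge to `u₀` in `L₂(∂Ω)`. In particular `u` lies in `H¹` up to the boundary. -/
def HasTrace (Ω : SmoothBody) (u : E3 → ℂ) (u₀ : Ω.L2Boundary) : Prop :=
  ∃ v : ℕ → E3 → ℂ, (∀ j, ContDiff ℝ ∞ (v j)) ∧
    (∀ R : ℝ, Tendsto
      (fun j => eLpNorm (fun x => u x - v j x) 2 (volume.restrict (Ω.exterior ∩ ball 0 R)))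
      atTop (𝓝 0)) ∧
    (∀ R : ℝ, Tendsto
      (fun j => eLpNorm (fun x => fderiv ℝ u x - fderiv ℝ (v j) x) 2
        (volume.restrict (Ω.exterior ∩ ball 0 R)))
      atTop (𝓝 0)) ∧
    Tendsto (fun j => eLpNorm (fun x : Ω.Boundary => u₀ x - v j x) 2 Ω.surfaceMeasure)
      atTop (𝓝 0)

/-- The product `∇u · ∇φ = ∑ ∂ᵢu ∂ᵢφ` (without complex conjugation). -/
def gradDot (u φ : E3 → ℂ) (x : E3) : ℂ :=
  ∑ i : Fin 3, fderiv ℝ u x (EuclideanSpace.single i 1) * fderiv ℝ φ x (EuclideanSpace.single i 1)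

/-- `g ∈ L₂(∂Ω)` is the derivative `∂u/∂n` on `∂Ω` of the function `u`, given in the exterior
domain, along the unit normal `n` which points into the exterior domain, in the usual variational
sense: `∫ (∇u·∇φ + Δu φ) dx = - ∫ g φ dS` for all smooth compactly supported `φ` on `ℝ³`, with the
volume integral over the exterior domain. For `u` of class `C²` outside and `C¹` up to the
boundary this is the classical normal derivative. -/
def HasNormalDerivative (Ω : SmoothBody) (u : E3 → ℂ) (g : Ω.L2Boundary) : Prop :=
  ∀ φ : E3 → ℂ, ContDiff ℝ ∞ φ → HasCompactSupport φ →
    ∫ x in Ω.exterior, (gradDot u φ x + (Δ u) x * φ x) =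
      - ∫ x : Ω.Boundary, g x * φ x ∂Ω.surfaceMeasure

/-- The radiation condition `∫_{|r| = R} |∂u/∂|r| - i k u|² dS → 0` as `R → ∞`; the sphere of
radius `R` is parametrised by the unit sphere, so that `dS = R² dμ`. -/
def RadiationCondition (k : ℝ) (u : E3 → ℂ) : Prop :=
  Tendsto
    (fun R : ℝ => R ^ 2 * ∫ θ : S2,
      ‖fderiv ℝ u (R • (θ : E3)) (θ : E3) - Complex.I * k * u (R • (θ : E3))‖ ^ 2 ∂areaS2)
    atTop (𝓝 0)

/-- `u` is a radiating solution of the Helmholtz equation in the exterior of `Ω`, with boundary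
values `u₀ ∈ L₂(∂Ω)` and normal derivative `g ∈ L₂(∂Ω)`. -/
structure IsRadiatingField (Ω : SmoothBody) (k : ℝ) (u : E3 → ℂ) (u₀ g : Ω.L2Boundary) :
    Prop where
  contDiffOn : ContDiffOn ℝ 2 u Ω.exterior
  helmholtz : ∀ x ∈ Ω.exterior, (Δ u) x + (k : ℂ) ^ 2 * u x = 0
  radiation : RadiationCondition k u
  hasTrace : HasTrace Ω u u₀
  hasNormalDerivative : HasNormalDerivative Ω u g

/-- `uinf` is the scattering amplitude of `u`:
`u(r) = (e^{ik|r|} / |r|) uinf(θ) + o(1 / |r|)` as `r → ∞`, where `r = |r| θ`. -/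
def IsScatteringAmplitude (k : ℝ) (u : E3 → ℂ) (uinf : S2 → ℂ) : Prop :=
  (fun p : ℝ × S2 => u (p.1 • (p.2 : E3)) - Complex.exp (Complex.I * k * p.1) / p.1 * uinf p.2)
    =o[atTop ×ˢ ⊤] fun p : ℝ × S2 => 1 / p.1

end

/-! ### Auxiliary facts on `L²` convergence and polar coordinates -/

/-! Everything rests on the energy flux of the difference `w = u - u₁`, whose boundary data satisfy
`h = -α - γ w₀`. Testing the Helmholtz equation with `χ w̄`, where `χ` is a real cutoff equal to 1
on `∂Ω`, and taking imaginary parts removes the terms in `|∇w|²` and `|w|²`. What remains equates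
`Im ∫ h w̄₀ dS` with `-Im ∫ (∇w·∇χ) w̄` (`IsWeakRadiatingField.im_integral_gradDot_cutoff`). For
radial `χ`, polar coordinates turn the latter into an average of the fluxes `Im ∫ ∂ᵣw w̄ dS` through
large spheres (`IsWeakRadiatingField.le_im_integral`), so no surface form of Green's formula on
spheres is needed.

By the radiation condition `∂ᵣw ≈ ikw`, these fluxes are nearly `k ∫ |w|² dS`. Hence the boundary
flux is nonnegative, and it is at least `k ‖w_∞‖²` when `w` has a scattering amplitude.

On `∂Ω` the impedance condition and `Im γ ≥ γ₀` give `γ₀ ‖w₀‖² + flux ≤ ‖α‖ ‖w₀‖`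
(`mul_norm_sq_add_im_integral_le`). Dropping the flux yields the first bound, the boundary condition
then yields the second, and dropping `γ₀ ‖w₀‖²` instead yields the third, even without its factor
`Γ/γ₀ + 1`. -/

theorem memLp_of_tendsto_eLpNorm_sub {X E : Type*} [MeasurableSpace X] [NormedAddCommGroup E]
    {μ : Measure X} {f : X → E} {F : ℕ → X → E} (hf : AEStronglyMeasurable f μ)
    (hF : ∀ j, MemLp (F j) 2 μ)
    (h : Tendsto (fun j => eLpNorm (fun x => f x - F j x) 2 μ) atTop (𝓝 0)) : MemLp f 2 μ := by
  obtain ⟨j, hj⟩ := (h.eventually (gt_mem_nhds (by simp : (0 : ℝ≥0∞) < 1))).exists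
  have h1 : MemLp (fun x => f x - F j x) 2 μ := ⟨hf.sub (hF j).1, hj.trans (by simp)⟩
  exact (h1.add (hF j)).ae_eq (Eventually.of_forall fun x => by simp)

/-- Hölder makes the products converge in `L¹`. Membership is asked only eventually because smooth
functions on the boundary are seen to be in `L²` only once they are close to the trace; finiteness
of the surface measure is never used. -/
theorem tendsto_integral_mul_conj {X : Type*} [MeasurableSpace X] {μ : Measure X}
    {p f : X → ℂ} {F : ℕ → X → ℂ} (hp : MemLp p 2 μ) (hf : MemLp f 2 μ)
    (hF : ∀ᶠ j in atTop, MemLp (F j) 2 μ)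
    (h : Tendsto (fun j => eLpNorm (fun x => f x - F j x) 2 μ) atTop (𝓝 0)) :
    Tendsto (fun j => ∫ x, p x * star (F j x) ∂μ) atTop (𝓝 (∫ x, p x * star (f x) ∂μ)) := by
  refine tendsto_integral_of_L1' (fun x => p x * star (f x))
    (hp.integrable_mul hf.star).aestronglyMeasurable
    (hF.mono fun j hj => hp.integrable_mul hj.star) ?_
  have h2 : Tendsto (fun j => eLpNorm p 2 μ * eLpNorm (fun x => f x - F j x) 2 μ) atTop (𝓝 0) := by
    simpa using ENNReal.Tendsto.const_mul h (Or.inr hp.2.ne)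
  refine tendsto_of_tendsto_of_tendsto_of_le_of_le' tendsto_const_nhds h2
    (Eventually.of_forall fun _ => zero_le) (hF.mono fun j hj => ?_)
  have e : ((fun x => p x * star (F j x)) - fun x => p x * star (f x))
      = p • (fun x => star (F j x - f x)) := by
    ext x; simp [mul_sub]
  have hm : AEStronglyMeasurable (fun x => star (F j x - f x)) μ := (hj.sub hf).star.1
  rw [e]
  refine (eLpNorm_smul_le_mul_eLpNorm (p := 2) (q := 2) hm hp.1).trans ?_
  gcongr
  refine (eLpNorm_congr_norm_ae (Eventually.of_forall fun x => ?_)).le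
  rw [norm_star, norm_sub_rev]

/-- Off the null set `{0}`, Lebesgue measure is the product of `areaS2` and `r² dr`, so this is
Fubini. -/
theorem integral_eq_integral_polar {F : E3 → ℝ} (hF : Integrable F) :
    IntegrableOn (fun r : ℝ => r ^ 2 * ∫ θ : S2, F (r • (θ : E3)) ∂areaS2) (Ioi 0) ∧
      ∫ x, F x = ∫ r in Ioi (0 : ℝ), r ^ 2 * ∫ θ : S2, F (r • (θ : E3)) ∂areaS2 := by
  have hd : Module.finrank ℝ E3 - 1 = 2 := by simp
  have hmp := (volume : Measure E3).measurePreserving_homeomorphUnitSphereProd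
  rw [hd] at hmp
  have hme := (homeomorphUnitSphereProd E3).measurableEmbedding
  set G : S2 × Ioi (0 : ℝ) → ℝ := fun p => F ((p.2 : ℝ) • (p.1 : E3)) with hG
  have hcomp : ∀ x : ({0}ᶜ : Set E3), G (homeomorphUnitSphereProd E3 x) = F x := by
    intro x
    have hx : ‖(x : E3)‖ ≠ 0 := norm_ne_zero_iff.2 x.2
    simp [hG, smul_smul, mul_inv_cancel₀ hx]
  have hGi : Integrable G (areaS2.prod (Measure.volumeIoiPow 2)) := by
    rw [← hmp.integrable_comp_emb hme]
    have : G ∘ homeomorphUnitSphereProd E3 = F ∘ Subtype.val := funext hcomp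
    rw [this, ← integrableOn_iff_comap_subtypeVal (by measurability)]
    exact hF.integrableOn
  have hFG : ∫ x, F x = ∫ p, G p ∂(areaS2.prod (Measure.volumeIoiPow 2)) := by
    rw [← hmp.integral_comp hme]
    simp_rw [hcomp]
    rw [integral_subtype_comap (by measurability) (fun x => F x), restrict_compl_singleton]
  have hden : Measurable fun r : Ioi (0 : ℝ) => Real.toNNReal ((r : ℝ) ^ 2) := by fun_prop
  have hI : Integrable (fun r : Ioi (0 : ℝ) => ∫ θ : S2, G (θ, r) ∂areaS2)
      (Measure.volumeIoiPow 2) := hGi.integral_prod_right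
  have hsm : ∀ (r : Ioi (0 : ℝ)) (y : ℝ), Real.toNNReal ((r : ℝ) ^ 2) • y = (r : ℝ) ^ 2 * y := by
    intro r y
    rw [NNReal.smul_def, Real.coe_toNNReal _ (sq_nonneg _), smul_eq_mul]
  constructor
  · rw [integrableOn_iff_comap_subtypeVal measurableSet_Ioi]
    rw [Measure.volumeIoiPow] at hI
    have h1 := (integrable_withDensity_iff_integrable_smul hden).1 hI
    simp_rw [hsm] at h1
    exact h1
  · rw [hFG, integral_prod_symm _ hGi, Measure.volumeIoiPow]
    have h1 := integral_withDensity_eq_integral_smul (μ := Measure.comap Subtype.val volume) hden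
      (fun r : Ioi (0 : ℝ) => ∫ θ : S2, G (θ, r) ∂areaS2)
    simp_rw [hsm] at h1
    refine Eq.trans h1 ?_
    exact integral_subtype_comap measurableSet_Ioi
      (fun r : ℝ => r ^ 2 * ∫ θ : S2, F (r • (θ : E3)) ∂areaS2)

/-! ### Functions on the exterior domain -/

namespace SmoothBody

variable (Ω : SmoothBody)

theorem isOpen_exterior : IsOpen Ω.exterior := Ω.isCompact_carrier.isClosed.isOpen_compl

theorem exists_radius : ∃ R₀ : ℝ, 0 < R₀ ∧ ∀ x : E3, x ∉ Ω.exterior → ‖x‖ < R₀ := by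
  obtain ⟨R, hR, h⟩ := Ω.isCompact_carrier.isBounded.exists_pos_norm_lt
  exact ⟨R, hR, fun x hx => h x (by simpa [exterior] using hx)⟩

theorem boundary_notMem_exterior (x : Ω.Boundary) : (x : E3) ∉ Ω.exterior := fun h =>
  h (Ω.isCompact_carrier.isClosed.frontier_subset x.2)

end SmoothBody

section Exterior

variable {Ω : SmoothBody} {u φ : E3 → ℂ} {R r : ℝ}

theorem ContDiffOn.continuousOn_fderiv_exterior (hu : ContDiffOn ℝ 2 u Ω.exterior) :
    ContinuousOn (fderiv ℝ u) Ω.exterior :=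
  hu.continuousOn_fderiv_of_isOpen Ω.isOpen_exterior (by norm_num)

theorem ContDiffOn.differentiableAt_exterior (hu : ContDiffOn ℝ 2 u Ω.exterior) {x : E3}
    (hx : x ∈ Ω.exterior) : DifferentiableAt ℝ u x :=
  (hu.differentiableOn (by norm_num)).differentiableAt (Ω.isOpen_exterior.mem_nhds hx)

/-- Lebesgue measure on the part of the exterior domain within distance `R` of the origin. -/
noncomputable def exteriorMeasure (Ω : SmoothBody) (R : ℝ) : Measure E3 :=
  volume.restrict (Ω.exterior ∩ ball 0 R)

instance : IsFiniteMeasure (exteriorMeasure Ω R) :=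
  ⟨by
    rw [exteriorMeasure, Measure.restrict_apply_univ]
    exact (measure_mono inter_subset_right).trans_lt measure_ball_lt_top⟩

theorem Continuous.memLp_exteriorMeasure {E : Type*} [NormedAddCommGroup E]
    [SecondCountableTopology E] {f : E3 → E} (hf : Continuous f) {p : ℝ≥0∞} :
    MemLp f p (exteriorMeasure Ω R) := by
  obtain ⟨C, hC⟩ := (isCompact_closedBall (0 : E3) R).exists_bound_of_continuousOn hf.continuousOn
  refine MemLp.of_bound hf.aestronglyMeasurable C ?_
  refine (ae_restrict_mem (Ω.isOpen_exterior.inter isOpen_ball).measurableSet).mono fun x hx => ?_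
  exact hC x (ball_subset_closedBall hx.2)

theorem ContinuousOn.aestronglyMeasurable_exteriorMeasure {E : Type*} [NormedAddCommGroup E]
    [SecondCountableTopology E] {f : E3 → E} (hf : ContinuousOn f Ω.exterior) :
    AEStronglyMeasurable f (exteriorMeasure Ω R) :=
  (hf.mono inter_subset_left).aestronglyMeasurable
    (Ω.isOpen_exterior.inter isOpen_ball).measurableSet

theorem HasTrace.memLp {u₀ : Ω.L2Boundary} (hu : ContDiffOn ℝ 2 u Ω.exterior)
    (h : HasTrace Ω u u₀) (R : ℝ) :
    MemLp u 2 (exteriorMeasure Ω R) ∧ MemLp (fderiv ℝ u) 2 (exteriorMeasure Ω R) := by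
  obtain ⟨v, hv, h0, h1, -⟩ := h
  exact ⟨memLp_of_tendsto_eLpNorm_sub hu.continuousOn.aestronglyMeasurable_exteriorMeasure
      (fun j => (hv j).continuous.memLp_exteriorMeasure) (h0 R),
    memLp_of_tendsto_eLpNorm_sub
      hu.continuousOn_fderiv_exterior.aestronglyMeasurable_exteriorMeasure
      (fun j => ((hv j).continuous_fderiv (by simp)).memLp_exteriorMeasure) (h1 R)⟩

theorem HasTrace.sub {u₁ : E3 → ℂ} {u₀ u₁₀ : Ω.L2Boundary} (hu : ContDiffOn ℝ 2 u Ω.exterior)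
    (h : HasTrace Ω u u₀) (hu₁ : ContDiffOn ℝ 2 u₁ Ω.exterior) (h₁ : HasTrace Ω u₁ u₁₀) :
    HasTrace Ω (u - u₁) (u₀ - u₁₀) := by
  -- One triangle inequality serves all three convergences in `HasTrace`. Agreement of `b` with `a -
  -- a₁` is only almost everywhere, as subtraction in `Lp` requires for the traces.
  have aux : ∀ {X E : Type} [MeasurableSpace X] [NormedAddCommGroup E] {μ : Measure X}
      {a a₁ b : X → E} {F F₁ G : ℕ → X → E},
      Tendsto (fun j => eLpNorm (fun x => a x - F j x) 2 μ) atTop (𝓝 0) →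
      Tendsto (fun j => eLpNorm (fun x => a₁ x - F₁ j x) 2 μ) atTop (𝓝 0) →
      AEStronglyMeasurable a μ → AEStronglyMeasurable a₁ μ →
      (∀ j, AEStronglyMeasurable (F j) μ) → (∀ j, AEStronglyMeasurable (F₁ j) μ) →
      (∀ᵐ x ∂μ, b x = a x - a₁ x) → (∀ j, G j = F j - F₁ j) →
      Tendsto (fun j => eLpNorm (fun x => b x - G j x) 2 μ) atTop (𝓝 0) := by
    intro X E _ _ μ a a₁ b F F₁ G h h₁ ha ha₁ hF hF₁ hb hG
    refine tendsto_of_tendsto_of_tendsto_of_le_of_le tendsto_const_nhds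
      (by simpa using h.add h₁) (fun _ => zero_le) (fun j => ?_)
    refine le_trans (le_of_eq ?_) (eLpNorm_sub_le (ha.sub (hF j)) (ha₁.sub (hF₁ j)) (by norm_num))
    refine eLpNorm_congr_ae (hb.mono fun x hx => ?_)
    simp only [hx, hG, Pi.sub_apply]
    abel
  obtain ⟨v, hv, h0, h1, h2⟩ := h
  obtain ⟨v₁, hv₁, h0₁, h1₁, h2₁⟩ := h₁
  have hmeas : MeasurableSet Ω.exterior := Ω.isOpen_exterior.measurableSet
  refine ⟨fun j => v j - v₁ j, fun j => (hv j).sub (hv₁ j), fun R => ?_, fun R => ?_, ?_⟩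
  · exact aux (h0 R) (h0₁ R) hu.continuousOn.aestronglyMeasurable_exteriorMeasure
      hu₁.continuousOn.aestronglyMeasurable_exteriorMeasure
      (fun j => (hv j).continuous.aestronglyMeasurable)
      (fun j => (hv₁ j).continuous.aestronglyMeasurable) (Eventually.of_forall fun _ => rfl)
      (fun _ => rfl)
  · refine aux (h1 R) (h1₁ R)
      hu.continuousOn_fderiv_exterior.aestronglyMeasurable_exteriorMeasure
      hu₁.continuousOn_fderiv_exterior.aestronglyMeasurable_exteriorMeasure
      (fun j => ((hv j).continuous_fderiv (by simp)).aestronglyMeasurable)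
      (fun j => ((hv₁ j).continuous_fderiv (by simp)).aestronglyMeasurable) ?_ ?_
    · refine (ae_restrict_mem (hmeas.inter measurableSet_ball)).mono fun x hx => ?_
      exact fderiv_sub (hu.differentiableAt_exterior hx.1) (hu₁.differentiableAt_exterior hx.1)
    · intro j
      ext1 x
      exact fderiv_sub ((hv j).differentiable (by simp) x) ((hv₁ j).differentiable (by simp) x)
  · refine aux (F := fun j (x : Ω.Boundary) => v j x) (F₁ := fun j (x : Ω.Boundary) => v₁ j x)
      h2 h2₁ (Lp.aestronglyMeasurable _) (Lp.aestronglyMeasurable _)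
      (fun j => ((hv j).continuous.comp continuous_subtype_val).aestronglyMeasurable)
      (fun j => ((hv₁ j).continuous.comp continuous_subtype_val).aestronglyMeasurable)
      (Lp.coeFn_sub _ _) (fun _ => rfl)

theorem continuous_restrict_sphere (hu : ContDiffOn ℝ 2 u Ω.exterior) (hr0 : 0 ≤ r)
    (hr : ∀ x : E3, x ∉ Ω.exterior → ‖x‖ < r) :
    Continuous (fun θ : S2 => u (r • (θ : E3))) ∧
      Continuous (fun θ : S2 => fderiv ℝ u (r • (θ : E3)) (θ : E3)) := by
  have hc : Continuous fun θ : S2 => r • (θ : E3) := by fun_prop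
  have hm : ∀ θ : S2, r • (θ : E3) ∈ Ω.exterior := fun θ => by
    by_contra h
    have := hr _ h
    simp [norm_smul, abs_of_nonneg hr0] at this
  exact ⟨hu.continuousOn.comp_continuous hc hm,
    (hu.continuousOn_fderiv_exterior.comp_continuous hc hm).clm_apply continuous_subtype_val⟩

end Exterior

theorem Continuous.integrable_areaS2 {E : Type*} [NormedAddCommGroup E]
    [SecondCountableTopology E] {f : S2 → E} (hf : Continuous f) : Integrable f areaS2 :=
  hf.integrable_of_hasCompactSupport (HasCompactSupport.of_compactSpace f)

/-! ### The weak form of the radiation problem -/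

/-- A radiating field, with the Helmholtz equation and the normal derivative given in weak form,
against test functions which are square integrable on the boundary. -/
structure IsWeakRadiatingField (Ω : SmoothBody) (k : ℝ) (w : E3 → ℂ) (w₀ h : Ω.L2Boundary) :
    Prop where
  contDiffOn : ContDiffOn ℝ 2 w Ω.exterior
  radiation : RadiationCondition k w
  hasTrace : HasTrace Ω w w₀
  weak : ∀ φ : E3 → ℂ, ContDiff ℝ ∞ φ → HasCompactSupport φ →
    MemLp (fun x : Ω.Boundary => φ x) 2 Ω.surfaceMeasure →
    ∫ x in Ω.exterior, (gradDot w φ x - (k : ℂ) ^ 2 * w x * φ x) =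
      - ∫ x : Ω.Boundary, h x * φ x ∂Ω.surfaceMeasure

theorem MeasureTheory.MemLp.integrable_mul_two {X : Type*} [MeasurableSpace X] {μ : Measure X} {p f : X → ℂ}
    (hp : MemLp p 2 μ) (hf : MemLp f 2 μ) : Integrable (fun x => p x * f x) μ :=
  MemLp.integrable_mul hp hf

theorem MeasureTheory.MemLp.integrable_mul_star {X : Type*} [MeasurableSpace X] {μ : Measure X} {p f : X → ℂ}
    (hp : MemLp p 2 μ) (hf : MemLp f 2 μ) : Integrable (fun x => p x * star (f x)) μ :=
  MemLp.integrable_mul hp hf.star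

section Weak

variable {Ω : SmoothBody} {k R : ℝ}

theorem HasCompactSupport.exists_ball {φ : E3 → ℂ} (hφ : HasCompactSupport φ) :
    ∃ R, 0 < R ∧ ∀ x, x ∉ ball (0 : E3) R → φ x = 0 ∧ fderiv ℝ φ x = 0 := by
  obtain ⟨R, hR, h⟩ := hφ.isCompact.isBounded.exists_pos_norm_lt
  have hx : ∀ x, x ∉ ball (0 : E3) R → x ∉ tsupport φ := fun x hx hx' => hx (by simpa using h x hx')
  exact ⟨R, hR, fun x hx' => ⟨image_eq_zero_of_notMem_tsupport (hx x hx'),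
    image_eq_zero_of_notMem_tsupport fun h' => hx x hx' (tsupport_fderiv_subset ℝ h')⟩⟩

theorem MeasureTheory.MemLp.fderiv_apply {μ : Measure E3} {w : E3 → ℂ} (hw : MemLp (fderiv ℝ w) 2 μ) (e : E3) :
    MemLp (fun x => fderiv ℝ w x e) 2 μ :=
  (ContinuousLinearMap.apply ℝ ℂ e).comp_memLp' hw

theorem integrableOn_exterior_gradDot_sub {w φ : E3 → ℂ}
    (hw : ∀ R, MemLp w 2 (exteriorMeasure Ω R) ∧ MemLp (fderiv ℝ w) 2 (exteriorMeasure Ω R))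
    (hφ : ContDiff ℝ ∞ φ) (hc : HasCompactSupport φ) :
    IntegrableOn (fun x => gradDot w φ x - (k : ℂ) ^ 2 * w x * φ x) Ω.exterior := by
  obtain ⟨R, hR, h0⟩ := hc.exists_ball
  have h1 : Integrable (fun x => gradDot w φ x - (k : ℂ) ^ 2 * w x * φ x)
      (exteriorMeasure Ω R) := by
    refine Integrable.sub (integrable_finsetSum _ fun i _ => ?_) ?_
    · exact (MemLp.fderiv_apply (hw R).2 _).integrable_mul
        (MemLp.fderiv_apply ((hφ.continuous_fderiv (by simp)).memLp_exteriorMeasure) _)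
    · exact ((hw R).1.const_mul _).integrable_mul_two hφ.continuous.memLp_exteriorMeasure
  refine IntegrableOn.of_forall_sdiff_eq_zero h1 Ω.isOpen_exterior.measurableSet fun x hx => ?_
  obtain ⟨h2, h3⟩ := h0 x fun h => hx.2 ⟨hx.1, h⟩
  simp [gradDot, h2, h3]

theorem IsRadiatingField.integral_gradDot_sub {u φ : E3 → ℂ} {u₀ g : Ω.L2Boundary}
    (hu : IsRadiatingField Ω k u u₀ g) (hφ : ContDiff ℝ ∞ φ) (hc : HasCompactSupport φ) :
    ∫ x in Ω.exterior, (gradDot u φ x - (k : ℂ) ^ 2 * u x * φ x) =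
      - ∫ x : Ω.Boundary, g x * φ x ∂Ω.surfaceMeasure := by
  rw [← hu.hasNormalDerivative φ hφ hc]
  refine setIntegral_congr_fun Ω.isOpen_exterior.measurableSet fun x hx => ?_
  have := hu.helmholtz x hx
  linear_combination (-φ x) * this

theorem gradDot_sub_left {u u₁ : E3 → ℂ} (φ : E3 → ℂ) {x : E3} (hu : DifferentiableAt ℝ u x)
    (hu₁ : DifferentiableAt ℝ u₁ x) :
    gradDot (u - u₁) φ x = gradDot u φ x - gradDot u₁ φ x := by
  simp only [gradDot, fderiv_sub hu hu₁, ← Finset.sum_sub_distrib, _root_.sub_apply,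
    sub_mul]

/-- Uses `|a - b|² ≤ 2|a|² + 2|b|²` on spheres large enough to lie in the exterior, where the
integrands are continuous. -/
theorem RadiationCondition.sub {u u₁ : E3 → ℂ} (hu : ContDiffOn ℝ 2 u Ω.exterior)
    (hu₁ : ContDiffOn ℝ 2 u₁ Ω.exterior) (h : RadiationCondition k u)
    (h₁ : RadiationCondition k u₁) : RadiationCondition k (u - u₁) := by
  obtain ⟨R₀, hR₀, hext⟩ := Ω.exists_radius
  have hlim := (h.const_mul 2).add (h₁.const_mul 2)
  simp only [mul_zero, add_zero] at hlim
  refine tendsto_of_tendsto_of_tendsto_of_le_of_le' tendsto_const_nhds hlim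
    (Eventually.of_forall fun R => mul_nonneg (sq_nonneg _)
      (integral_nonneg fun θ => sq_nonneg _)) ?_
  filter_upwards [eventually_ge_atTop R₀] with R hR
  have hr : ∀ x : E3, x ∉ Ω.exterior → ‖x‖ < R := fun x hx => (hext x hx).trans_le hR
  have hR0 := hR₀.le.trans hR
  obtain ⟨c1, c2⟩ := continuous_restrict_sphere hu hR0 hr
  obtain ⟨c3, c4⟩ := continuous_restrict_sphere hu₁ hR0 hr
  have hm : ∀ θ : S2, R • (θ : E3) ∈ Ω.exterior := fun θ => by
    by_contra h
    have := hr _ h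
    simp [norm_smul, abs_of_nonneg hR0] at this
  have i1 : Integrable (fun θ : S2 => ‖fderiv ℝ u (R • (θ : E3)) (θ : E3)
      - Complex.I * k * u (R • (θ : E3))‖ ^ 2) areaS2 :=
    ((c2.sub (continuous_const.mul c1)).norm.pow 2).integrable_areaS2
  have i2 : Integrable (fun θ : S2 => ‖fderiv ℝ u₁ (R • (θ : E3)) (θ : E3)
      - Complex.I * k * u₁ (R • (θ : E3))‖ ^ 2) areaS2 :=
    ((c4.sub (continuous_const.mul c3)).norm.pow 2).integrable_areaS2
  have key : ∫ θ : S2, ‖fderiv ℝ (u - u₁) (R • (θ : E3)) (θ : E3)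
        - Complex.I * k * (u - u₁) (R • (θ : E3))‖ ^ 2 ∂areaS2
      ≤ 2 * (∫ θ : S2, ‖fderiv ℝ u (R • (θ : E3)) (θ : E3)
          - Complex.I * k * u (R • (θ : E3))‖ ^ 2 ∂areaS2)
        + 2 * ∫ θ : S2, ‖fderiv ℝ u₁ (R • (θ : E3)) (θ : E3)
          - Complex.I * k * u₁ (R • (θ : E3))‖ ^ 2 ∂areaS2 := by
    rw [← integral_const_mul, ← integral_const_mul,
      ← integral_add (i1.const_mul 2) (i2.const_mul 2)]
    refine integral_mono_of_nonneg (Eventually.of_forall fun θ => sq_nonneg _)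
      ((i1.const_mul 2).add (i2.const_mul 2)) (Eventually.of_forall fun θ => ?_)
    have hx := hm θ
    simp only [fderiv_sub (hu.differentiableAt_exterior hx) (hu₁.differentiableAt_exterior hx),
      _root_.sub_apply, Pi.sub_apply]
    set a := fderiv ℝ u (R • (θ : E3)) (θ : E3) - Complex.I * k * u (R • (θ : E3))
    set b := fderiv ℝ u₁ (R • (θ : E3)) (θ : E3) - Complex.I * k * u₁ (R • (θ : E3))
    have e : fderiv ℝ u (R • (θ : E3)) (θ : E3) - fderiv ℝ u₁ (R • (θ : E3)) (θ : E3)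
        - Complex.I * k * (u (R • (θ : E3)) - u₁ (R • (θ : E3))) = a - b := by ring
    rw [e]
    nlinarith [parallelogram_law_with_norm ℝ a b, sq_nonneg ‖a + b‖]
  calc _ ≤ R ^ 2 * _ := mul_le_mul_of_nonneg_left key (sq_nonneg R)
    _ = _ := by ring

theorem IsRadiatingField.sub {u u₁ : E3 → ℂ} {u₀ g u₁₀ g₁ : Ω.L2Boundary}
    (hu : IsRadiatingField Ω k u u₀ g) (hu₁ : IsRadiatingField Ω k u₁ u₁₀ g₁) :
    IsWeakRadiatingField Ω k (u - u₁) (u₀ - u₁₀) (g - g₁) where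
  contDiffOn := hu.contDiffOn.sub hu₁.contDiffOn
  radiation := hu.radiation.sub hu.contDiffOn hu₁.contDiffOn hu₁.radiation
  hasTrace := hu.hasTrace.sub hu.contDiffOn hu₁.contDiffOn hu₁.hasTrace
  weak := by
    intro φ hφ hc hL
    have i1 := integrableOn_exterior_gradDot_sub (k := k)
      (fun R => hu.hasTrace.memLp hu.contDiffOn R) hφ hc
    have i2 := integrableOn_exterior_gradDot_sub (k := k)
      (fun R => hu₁.hasTrace.memLp hu₁.contDiffOn R) hφ hc
    have e1 : ∫ x in Ω.exterior, (gradDot (u - u₁) φ x - (k : ℂ) ^ 2 * (u - u₁) x * φ x) =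
        (∫ x in Ω.exterior, (gradDot u φ x - (k : ℂ) ^ 2 * u x * φ x)) -
        ∫ x in Ω.exterior, (gradDot u₁ φ x - (k : ℂ) ^ 2 * u₁ x * φ x) := by
      rw [← integral_sub i1 i2]
      refine setIntegral_congr_fun Ω.isOpen_exterior.measurableSet fun x hx => ?_
      simp only [gradDot_sub_left φ (hu.contDiffOn.differentiableAt_exterior hx)
        (hu₁.contDiffOn.differentiableAt_exterior hx), Pi.sub_apply]
      ring
    -- Square integrability of `φ` on the boundary is needed here, to split the boundary integral.
    have e2 : ∫ x : Ω.Boundary, (g - g₁) x * φ x ∂Ω.surfaceMeasure =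
        (∫ x : Ω.Boundary, g x * φ x ∂Ω.surfaceMeasure) -
        ∫ x : Ω.Boundary, g₁ x * φ x ∂Ω.surfaceMeasure := by
      rw [← integral_sub ((Lp.memLp g).integrable_mul_two hL) ((Lp.memLp g₁).integrable_mul_two hL)]
      refine integral_congr_ae ((Lp.coeFn_sub g g₁).mono fun x hx => ?_)
      simp only [hx, Pi.sub_apply, sub_mul]
    rw [e1, e2, hu.integral_gradDot_sub hφ hc, hu₁.integral_gradDot_sub hφ hc]
    ring

/-! ### The energy identity -/

theorem im_integral_mul_star_self {X : Type*} [MeasurableSpace X] {μ : Measure X}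
    (c : X → ℝ) (f : X → ℂ) : (∫ x, (c x : ℂ) * f x * star (f x) ∂μ).im = 0 := by
  have : ∀ x, (c x : ℂ) * f x * star (f x) = ((c x * Complex.normSq (f x) : ℝ) : ℂ) := by
    intro x
    rw [mul_assoc, ← starRingEnd_apply, Complex.mul_conj]
    push_cast
    rfl
  simp_rw [this]
  exact (congrArg Complex.im integral_complex_ofReal).trans (Complex.ofReal_im _)

/-- Green's identity: the imaginary part of the energy identity obtained by testing the equation
with the complex conjugate of the field, cut off by `χ`. -/
theorem IsWeakRadiatingField.im_integral_gradDot_cutoff {w : E3 → ℂ} {w₀ h : Ω.L2Boundary}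
    (hw : IsWeakRadiatingField Ω k w w₀ h) {χ : E3 → ℝ} (hχ : ContDiff ℝ ∞ χ)
    (hR : ∀ x, x ∉ ball (0 : E3) R → χ x = 0) (hχ1 : ∀ x ∈ frontier Ω.carrier, χ x = 1) :
    Integrable (fun x => gradDot w (fun y => (χ y : ℂ)) x * star (w x)) (exteriorMeasure Ω R) ∧
      (∫ x, gradDot w (fun y => (χ y : ℂ)) x * star (w x) ∂exteriorMeasure Ω R).im =
        - (∫ x : Ω.Boundary, h x * star (w₀ x) ∂Ω.surfaceMeasure).im := by
  obtain ⟨hw2, hdw2⟩ := hw.hasTrace.memLp hw.contDiffOn R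
  obtain ⟨v, hv, hv0, hv1, hv2⟩ := hw.hasTrace
  set χc : E3 → ℂ := fun y => (χ y : ℂ) with hχc
  have hχcs : ContDiff ℝ ∞ χc := Complex.ofRealCLM.contDiff.comp hχ
  let e : Fin 3 → E3 := fun i => EuclideanSpace.single i 1
  have hp : ∀ i, MemLp (fun x => χc x * fderiv ℝ w x (e i)) 2 (exteriorMeasure Ω R) := fun i =>
    MemLp.mul (p := ∞) (q := 2) (MemLp.fderiv_apply hdw2 (e i))
      hχcs.continuous.memLp_exteriorMeasure
  have hdχ : ∀ i, Continuous fun x => fderiv ℝ χc x (e i) := fun i =>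
    (hχcs.continuous_fderiv (by simp)).clm_apply continuous_const
  have hg : MemLp (gradDot w χc) 2 (exteriorMeasure Ω R) := by
    refine memLp_finsetSum _ fun i _ => ?_
    exact MemLp.mul (p := 2) (q := ∞) (hdχ i).memLp_exteriorMeasure
      (MemLp.fderiv_apply hdw2 (e i))
  have hq : MemLp (fun x => gradDot w χc x - (k : ℂ) ^ 2 * (χc x * w x)) 2
      (exteriorMeasure Ω R) :=
    hg.sub ((MemLp.mul (p := ∞) (q := 2) hw2
      hχcs.continuous.memLp_exteriorMeasure).const_mul _)
  have hvm : ∀ j, MemLp (v j) 2 (exteriorMeasure Ω R) := fun j =>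
    (hv j).continuous.memLp_exteriorMeasure
  have hdvm : ∀ j, MemLp (fderiv ℝ (v j)) 2 (exteriorMeasure Ω R) := fun j =>
    ((hv j).continuous_fderiv (by simp)).memLp_exteriorMeasure
  have hvb : ∀ᶠ j in atTop, MemLp (fun x : Ω.Boundary => v j x) 2 Ω.surfaceMeasure := by
    filter_upwards [hv2.eventually (gt_mem_nhds (by simp : (0 : ℝ≥0∞) < 1))] with j hj
    have hm : AEStronglyMeasurable (fun x : Ω.Boundary => v j x) Ω.surfaceMeasure :=
      ((hv j).continuous.comp continuous_subtype_val).aestronglyMeasurable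
    have h1 : MemLp (fun x : Ω.Boundary => w₀ x - v j x) 2 Ω.surfaceMeasure :=
      ⟨(Lp.aestronglyMeasurable w₀).sub hm, hj.trans (by simp)⟩
    exact ((Lp.memLp w₀).sub h1).ae_eq (Eventually.of_forall fun x => by simp)
  have hdv1 : ∀ i, Tendsto (fun j => eLpNorm (fun x => fderiv ℝ w x (e i) - fderiv ℝ (v j) x (e i))
      2 (exteriorMeasure Ω R)) atTop (𝓝 0) := by
    intro i
    refine tendsto_of_tendsto_of_tendsto_of_le_of_le tendsto_const_nhds (hv1 R)
      (fun _ => zero_le) (fun j => ?_)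
    refine eLpNorm_mono fun x => ?_
    rw [← _root_.sub_apply]
    refine (ContinuousLinearMap.le_opNorm _ _).trans (by simp [e])
  -- Both sides of the weak equation converge as the approximating functions do.
  have lim1 := (tendsto_finsetSum Finset.univ fun i _ =>
    tendsto_integral_mul_conj (hp i) (MemLp.fderiv_apply hdw2 (e i))
      (Eventually.of_forall fun j => MemLp.fderiv_apply (hdvm j) (e i)) (hdv1 i)).add
    (tendsto_integral_mul_conj hq hw2 (Eventually.of_forall hvm) (hv0 R))
  have lim2 := (tendsto_integral_mul_conj (Lp.memLp h) (Lp.memLp w₀) hvb hv2).neg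
  have heq : ∀ᶠ j in atTop,
      (∑ i, ∫ x, χc x * fderiv ℝ w x (e i) * star (fderiv ℝ (v j) x (e i)) ∂exteriorMeasure Ω R)
        + ∫ x, (gradDot w χc x - (k : ℂ) ^ 2 * (χc x * w x)) * star (v j x) ∂exteriorMeasure Ω R
      = - ∫ x : Ω.Boundary, h x * star (v j x) ∂Ω.surfaceMeasure := by
    filter_upwards [hvb] with j hj
    -- The field `w` need not be smooth up to the boundary, so the conjugates of its smooth
    -- approximants are used for testing.
    set φ : E3 → ℂ := fun x => χc x * star (v j x) with hφ
    have hφs : ContDiff ℝ ∞ φ :=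
      hχcs.mul ((starL' ℝ : ℂ ≃L[ℝ] ℂ).toContinuousLinearMap.contDiff.comp (hv j))
    have hφ0 : ∀ x, x ∉ ball (0 : E3) R → φ x = 0 := fun x hx => by simp [hφ, hχc, hR x hx]
    have hφc : HasCompactSupport φ :=
      HasCompactSupport.intro (isCompact_closedBall (0 : E3) R) fun x hx =>
        hφ0 x fun h => hx (ball_subset_closedBall h)
    have hφb : ∀ x : Ω.Boundary, φ x = star (v j x) := fun x => by
      simp [hφ, hχc, hχ1 x x.2]
    have hweak := hw.weak φ hφs hφc (by simp only [hφb]; exact hj.star)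
    simp only [hφb] at hweak
    rw [← hweak]
    have hder : ∀ x y, fderiv ℝ φ x y =
        χc x * star (fderiv ℝ (v j) x y) + fderiv ℝ χc x y * star (v j x) := by
      intro x y
      have h1 : HasFDerivAt χc (fderiv ℝ χc x) x := (hχcs.differentiable (by simp) x).hasFDerivAt
      have h2 : HasFDerivAt (v j) (fderiv ℝ (v j) x) x :=
        ((hv j).differentiable (by simp) x).hasFDerivAt
      have h3 := h1.mul h2.star
      rw [show fderiv ℝ φ x = _ from h3.fderiv]
      simp [mul_comm]
    have hpt : ∀ x, gradDot w φ x - (k : ℂ) ^ 2 * w x * φ x =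
        (∑ i, χc x * fderiv ℝ w x (e i) * star (fderiv ℝ (v j) x (e i))) +
          (gradDot w χc x - (k : ℂ) ^ 2 * (χc x * w x)) * star (v j x) := by
      intro x
      simp only [gradDot, hder, sub_mul, Finset.sum_mul, e]
      rw [add_sub, ← Finset.sum_add_distrib]
      congr 1
      · exact Finset.sum_congr rfl fun i _ => by ring
      · simp only [hφ]
        ring
    have hset : ∫ x in Ω.exterior, (gradDot w φ x - (k : ℂ) ^ 2 * w x * φ x) =
        ∫ x, (gradDot w φ x - (k : ℂ) ^ 2 * w x * φ x) ∂exteriorMeasure Ω R := by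
      refine setIntegral_eq_of_subset_of_ae_sdiff_eq_zero
        Ω.isOpen_exterior.measurableSet.nullMeasurableSet inter_subset_left ?_
      -- The cutoff vanishes off the open ball, so the derivative of `φ` vanishes outside the closed
      -- ball; the sphere between is null.
      have hsph : ∀ᵐ x : E3, x ∉ sphere (0 : E3) R := by
        rw [← measure_eq_zero_iff_ae_notMem]
        exact Measure.addHaar_sphere _ _ _
      filter_upwards [hsph] with x hxs hx
      have hx' : x ∉ ball (0 : E3) R := fun h' => hx.2 ⟨hx.1, h'⟩
      have hx'' : x ∉ closedBall (0 : E3) R := fun h' => by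
        rw [← ball_union_sphere] at h'
        exact h'.elim hx' hxs
      have hloc : φ =ᶠ[𝓝 x] fun _ => 0 := by
        filter_upwards [isClosed_closedBall.isOpen_compl.mem_nhds hx''] with y hy
        exact hφ0 y fun h' => hy (ball_subset_closedBall h')
      simp [gradDot, hloc.fderiv_eq, hφ0 x hx']
    rw [hset]
    simp_rw [hpt]
    rw [integral_add (integrable_finsetSum _ fun i _ =>
      (hp i).integrable_mul_star (MemLp.fderiv_apply (hdvm j) (e i)))
      (hq.integrable_mul_star (hvm j)), integral_finsetSum _ fun i _ =>
      (hp i).integrable_mul_star (MemLp.fderiv_apply (hdvm j) (e i))]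
  have hlim := congrArg Complex.im (tendsto_nhds_unique (lim1.congr' heq) lim2)
  have hgi := hg.integrable_mul_star hw2
  refine ⟨hgi, ?_⟩
  have hki : Integrable (fun x => (((k ^ 2 * χ x : ℝ) : ℂ)) * w x * star (w x))
      (exteriorMeasure Ω R) := by
    have := (((MemLp.mul (p := ∞) (q := 2) hw2
      hχcs.continuous.memLp_exteriorMeasure).const_mul ((k : ℂ) ^ 2))).integrable_mul_star hw2
    refine this.congr (Eventually.of_forall fun x => ?_)
    simp [hχc, mul_assoc]
  have hsplit : ∫ x, (gradDot w χc x - (k : ℂ) ^ 2 * (χc x * w x)) * star (w x)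
        ∂exteriorMeasure Ω R
      = (∫ x, gradDot w χc x * star (w x) ∂exteriorMeasure Ω R)
        - ∫ x, (((k ^ 2 * χ x : ℝ) : ℂ)) * w x * star (w x) ∂exteriorMeasure Ω R := by
    rw [← integral_sub hgi hki]
    refine integral_congr_ae (Eventually.of_forall fun x => ?_)
    simp [hχc, sub_mul, mul_assoc]
  -- The coefficients `χ` and `k²χ` are real, so the gradient and zeroth-order terms have no
  -- imaginary part.
  rw [hsplit, Complex.add_im, Complex.sub_im, Complex.im_sum, im_integral_mul_star_self,
    Finset.sum_eq_zero fun i _ => im_integral_mul_star_self χ fun x => fderiv ℝ w x (e i)] at hlim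
  simpa using hlim

end Weak

/-! ### The flux through large spheres -/

theorem deriv_smoothTransition_eq_zero {t : ℝ} (h : t < 0 ∨ 1 < t) :
    deriv Real.smoothTransition t = 0 := by
  rcases h with h | h
  · have : Real.smoothTransition =ᶠ[𝓝 t] fun _ => 0 :=
      (eventually_lt_nhds h).mono fun s hs => Real.smoothTransition.zero_of_nonpos hs.le
    simp [this.deriv_eq]
  · have : Real.smoothTransition =ᶠ[𝓝 t] fun _ => 1 :=
      (eventually_gt_nhds h).mono fun s hs => Real.smoothTransition.one_of_one_le hs.le
    simp [this.deriv_eq]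

/-- A weight on `(0, ∞)` concentrated on `[R, R + 1]`: the negative of the derivative of
`r ↦ smoothTransition (R² + 1 - r²)`. -/
noncomputable def radialWeight (R r : ℝ) : ℝ := deriv Real.smoothTransition (R ^ 2 + 1 - r ^ 2) * (2 * r)

theorem radialWeight_nonneg (R : ℝ) {r : ℝ} (hr : 0 < r) : 0 ≤ radialWeight R r :=
  mul_nonneg Real.smoothTransition.monotone.deriv_nonneg (by positivity)

/-- The derivative of the transition lives where `0 ≤ R² + 1 - r² ≤ 1`, that is `R ≤ r ≤ √(R² + 1)`,
and `√(R² + 1) < R + 1`. -/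
theorem radialWeight_eq_zero {R r : ℝ} (hR : 0 < R) (hr : 0 < r) (h : r < R ∨ R + 1 ≤ r) :
    radialWeight R r = 0 := by
  rw [radialWeight, deriv_smoothTransition_eq_zero, zero_mul]
  rcases h with h | h
  · right; nlinarith
  · left; nlinarith

/-- The primitive `-smoothTransition (R² + 1 - r²)` rises from -1 at `r = 0` to 0 at infinity. -/
theorem integral_radialWeight (R : ℝ) :
    IntegrableOn (radialWeight R) (Ioi 0) ∧ ∫ r in Ioi 0, radialWeight R r = 1 := by
  have hd : ∀ r, HasDerivAt (fun r : ℝ => -Real.smoothTransition (R ^ 2 + 1 - r ^ 2))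
      (radialWeight R r) r := by
    intro r
    have h1 : HasDerivAt (fun r : ℝ => R ^ 2 + 1 - r ^ 2) (-(2 * r)) r := by
      simpa using (hasDerivAt_pow 2 r).const_sub (R ^ 2 + 1)
    have h2 : HasDerivAt Real.smoothTransition _ (R ^ 2 + 1 - r ^ 2) :=
      ((Real.smoothTransition.contDiff (n := 1)).differentiable (by simp) _).hasDerivAt
    refine (h2.comp r h1).neg.congr_deriv ?_
    rw [radialWeight]
    ring
  have hl : Tendsto (fun r : ℝ => -Real.smoothTransition (R ^ 2 + 1 - r ^ 2)) atTop (𝓝 0) := by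
    refine tendsto_const_nhds.congr' ?_
    filter_upwards [eventually_ge_atTop (|R| + 1)] with r hr
    rw [Real.smoothTransition.zero_of_nonpos, neg_zero]
    nlinarith [sq_abs R, abs_nonneg R]
  have hn : ∀ r ∈ Ioi (0 : ℝ), 0 ≤ radialWeight R r := fun r hr => radialWeight_nonneg R hr
  refine ⟨integrableOn_Ioi_deriv_of_nonneg' (fun r _ => hd r) hn hl, ?_⟩
  rw [integral_Ioi_of_hasDerivAt_of_nonneg' (fun r _ => hd r) hn hl,
    Real.smoothTransition.one_of_one_le (by nlinarith [sq_nonneg R])]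
  norm_num

/-- The smooth radial cutoff equal to `1` on the ball of radius `R`. -/
noncomputable def radialCutoff (R : ℝ) (x : E3) : ℝ := Real.smoothTransition (R ^ 2 + 1 - ‖x‖ ^ 2)

theorem contDiff_radialCutoff (R : ℝ) : ContDiff ℝ ∞ (radialCutoff R) :=
  Real.smoothTransition.contDiff.comp (contDiff_const.sub (contDiff_norm_sq ℝ))

/-- The gradient of a function of `‖x‖²` is a multiple of `x`, so only the derivative of `w` along
`x` survives. At `x = rθ` this is `r ∂ᵣw`, the source of the factor `2r` in `radialWeight`. -/
theorem gradDot_radialCutoff (w : E3 → ℂ) (R : ℝ) (x : E3) :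
    gradDot w (fun y => (radialCutoff R y : ℂ)) x =
      -((deriv Real.smoothTransition (R ^ 2 + 1 - ‖x‖ ^ 2) * 2 : ℝ) : ℂ) * fderiv ℝ w x x := by
  have hd : ∀ y, fderiv ℝ (fun y => (radialCutoff R y : ℂ)) x y =
      ((deriv Real.smoothTransition (R ^ 2 + 1 - ‖x‖ ^ 2) * (-(2 * ⟪x, y⟫_ℝ)) : ℝ) : ℂ) := by
    intro y
    have h1 : HasFDerivAt (fun y : E3 => R ^ 2 + 1 - ‖y‖ ^ 2) (-(2 • innerSL ℝ x)) x :=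
      (hasStrictFDerivAt_norm_sq x).hasFDerivAt.const_sub _
    have h2 : HasDerivAt Real.smoothTransition _ (R ^ 2 + 1 - ‖x‖ ^ 2) :=
      ((Real.smoothTransition.contDiff (n := 1)).differentiable (by simp) _).hasDerivAt
    have h3 := Complex.ofRealCLM.hasFDerivAt.comp x (h2.comp_hasFDerivAt x h1)
    rw [show fderiv ℝ (fun y => (radialCutoff R y : ℂ)) x = _ from h3.fderiv]
    simp
  have hx : x = ∑ i : Fin 3, x i • EuclideanSpace.single i (1 : ℝ) := by
    simpa using ((EuclideanSpace.basisFun (Fin 3) ℝ).sum_repr x).symm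
  have hsum : fderiv ℝ w x x = ∑ i : Fin 3, (x i : ℂ) * fderiv ℝ w x (EuclideanSpace.single i 1) := by
    have := congrArg (fderiv ℝ w x) hx
    rw [map_sum] at this
    simpa using this
  rw [hsum, gradDot, Finset.mul_sum]
  refine Finset.sum_congr rfl fun i _ => ?_
  rw [hd, EuclideanSpace.inner_single_right]
  push_cast
  simp
  ring

section Flux

variable {Ω : SmoothBody} {k : ℝ} {w : E3 → ℂ} {w₀ h : Ω.L2Boundary}

/-- The energy flux `Im ∫ ∂w/∂r w̄ dS` through the sphere of radius `r`. -/
noncomputable def sphereFlux (w : E3 → ℂ) (r : ℝ) : ℝ :=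
  r ^ 2 * ∫ θ : S2, (fderiv ℝ w (r • (θ : E3)) (θ : E3) * star (w (r • (θ : E3)))).im ∂areaS2

/-- The flux through the boundary is an average of the fluxes through large spheres. -/
theorem IsWeakRadiatingField.le_im_integral (hw : IsWeakRadiatingField Ω k w w₀ h) {c : ℝ}
    (hc : ∀ᶠ r in atTop, c ≤ sphereFlux w r) :
    c ≤ (∫ x : Ω.Boundary, h x * star (w₀ x) ∂Ω.surfaceMeasure).im := by
  obtain ⟨R₀, hR₀, hext⟩ := Ω.exists_radius
  obtain ⟨R₁, hR₁⟩ := eventually_atTop.1 hc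
  -- Beyond `R₀` the cutoff is 1 on the body; beyond `R₁` the flux bound holds on the whole support
  -- of the weight.
  set R := max R₀ R₁
  have hRpos : 0 < R := hR₀.trans_le (le_max_left _ _)
  obtain ⟨hint, him⟩ := hw.im_integral_gradDot_cutoff (R := R + 1) (contDiff_radialCutoff R)
    (fun x hx => by
      have : R + 1 ≤ ‖x‖ := by simpa using hx
      exact Real.smoothTransition.zero_of_nonpos (by nlinarith))
    (fun x hx => by
      have : ‖x‖ < R := (hext x (Ω.boundary_notMem_exterior ⟨x, hx⟩)).trans_le (le_max_left _ _)
      exact Real.smoothTransition.one_of_one_le (by nlinarith [norm_nonneg x]))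
  set f : E3 → ℂ := fun x => gradDot w (fun y => (radialCutoff R y : ℂ)) x * star (w x) with hf
  set A : Set E3 := Ω.exterior ∩ ball 0 (R + 1) with hA
  have hAm : MeasurableSet A := (Ω.isOpen_exterior.inter isOpen_ball).measurableSet
  set F : E3 → ℝ := A.indicator fun x => (f x).im
  have hFi : Integrable F := (integrable_indicator_iff hAm).2 hint.im
  have hF : ∫ x, F x = - (∫ x : Ω.Boundary, h x * star (w₀ x) ∂Ω.surfaceMeasure).im := by
    rw [← him, integral_indicator hAm]
    exact (integral_im hint)
  obtain ⟨hpi, hp⟩ := integral_eq_integral_polar hFi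
  have hpt : ∀ r ∈ Ioi (0 : ℝ), r ^ 2 * ∫ θ : S2, F (r • (θ : E3)) ∂areaS2 =
      - (radialWeight R r * sphereFlux w r) := by
    intro r hr
    have hr0 : 0 < r := hr
    have : ∀ θ : S2, F (r • (θ : E3)) = (-radialWeight R r) *
        (fderiv ℝ w (r • (θ : E3)) (θ : E3) * star (w (r • (θ : E3)))).im := by
      intro θ
      have hn : ‖r • (θ : E3)‖ = r := by simp [norm_smul, abs_of_pos hr0]
      have hfe : (f (r • (θ : E3))).im = (-radialWeight R r) *
          (fderiv ℝ w (r • (θ : E3)) (θ : E3) * star (w (r • (θ : E3)))).im := by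
        simp only [hf, gradDot_radialCutoff, hn, map_smul]
        rw [← Complex.im_ofReal_mul]
        simp only [radialWeight, Complex.real_smul]
        congr 1
        push_cast
        ring
      by_cases hm : r • (θ : E3) ∈ A
      · exact (indicator_of_mem hm _).trans hfe
      -- A point outside `A` has norm at least `R + 1` or lies in the body, hence has norm below
      -- `R`; the weight vanishes in both cases.
      · rw [show F (r • (θ : E3)) = 0 from indicator_of_notMem hm _,
          radialWeight_eq_zero hRpos hr0, neg_zero, zero_mul]
        by_cases hext' : r • (θ : E3) ∈ Ω.exterior
        · right
          by_contra hlt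
          exact hm ⟨hext', by simpa [hn] using hlt⟩
        · left
          have := hext _ hext'
          rw [hn] at this
          exact this.trans_le (le_max_left _ _)
    simp_rw [this]
    rw [integral_const_mul, sphereFlux]
    ring
  obtain ⟨hwi, hw1⟩ := integral_radialWeight R
  rw [integrableOn_congr_fun hpt measurableSet_Ioi] at hpi
  rw [hF, setIntegral_congr_fun measurableSet_Ioi hpt, integral_neg, neg_inj] at hp
  rw [hp]
  calc c = ∫ r in Ioi 0, radialWeight R r * c := by rw [integral_mul_const, hw1, one_mul]
    _ ≤ _ := by
      refine setIntegral_mono_on (hwi.mul_const c) ?_ measurableSet_Ioi fun r hr => ?_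
      · simpa using hpi.neg
      · rcases lt_or_ge r R with hlt | hge
        · rw [radialWeight_eq_zero hRpos hr (Or.inl hlt), zero_mul, zero_mul]
        · exact mul_le_mul_of_nonneg_left (hR₁ r ((le_max_right _ _).trans hge))
            (radialWeight_nonneg R hr)

/-! ### Lower bounds for the flux from the radiation condition -/

theorem le_im_mul_star (a b : ℂ) (k : ℝ) {δ : ℝ} (hδ : 0 < δ) :
    (k - δ) * ‖b‖ ^ 2 - (4 * δ)⁻¹ * ‖a - Complex.I * k * b‖ ^ 2 ≤ (a * star b).im := by
  set s := a - Complex.I * k * b with hs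
  have ha : a = s + Complex.I * k * b := by rw [hs]; ring
  have h1 : (a * star b).im = (s * star b).im + k * ‖b‖ ^ 2 := by
    rw [ha, add_mul, Complex.add_im, mul_assoc _ b, ← starRingEnd_apply, Complex.mul_conj,
      Complex.normSq_eq_norm_sq]
    congr 1
    rw [mul_assoc, ← Complex.ofReal_mul, Complex.I_mul_im, Complex.ofReal_re]
  have h2 : -(‖s‖ * ‖b‖) ≤ (s * star b).im := by
    have := Complex.abs_im_le_norm (s * star b)
    rw [norm_mul, norm_star] at this
    exact (abs_le.1 this).1
  have h3 : ‖s‖ * ‖b‖ ≤ δ * ‖b‖ ^ 2 + (4 * δ)⁻¹ * ‖s‖ ^ 2 := by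
    -- Young's inequality with parameter `δ`, by completing the square.
    have : δ * ‖b‖ ^ 2 + (4 * δ)⁻¹ * ‖s‖ ^ 2 - ‖s‖ * ‖b‖ = (4 * δ)⁻¹ * (2 * δ * ‖b‖ - ‖s‖) ^ 2 := by
      field_simp; ring
    have h4 : 0 ≤ (4 * δ)⁻¹ * (2 * δ * ‖b‖ - ‖s‖) ^ 2 := by positivity
    linarith
  rw [h1]
  linarith

/-- The cross term costs `δ ∫ |w|²`, absorbed into `k`, so no prior bound on `∫ |w|² dS` is needed.
The radiation defect is eventually below `4δε`, which cancels `(4δ)⁻¹`. -/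
theorem IsWeakRadiatingField.le_sphereFlux (hw : IsWeakRadiatingField Ω k w w₀ h) {δ ε : ℝ}
    (hδ : 0 < δ) (hε : 0 < ε) : ∀ᶠ r in atTop,
      (k - δ) * (r ^ 2 * ∫ θ : S2, ‖w (r • (θ : E3))‖ ^ 2 ∂areaS2) - ε ≤ sphereFlux w r := by
  obtain ⟨R₀, hR₀, hext⟩ := Ω.exists_radius
  have hrad : ∀ᶠ r in atTop, r ^ 2 * ∫ θ : S2, ‖fderiv ℝ w (r • (θ : E3)) (θ : E3)
      - Complex.I * k * w (r • (θ : E3))‖ ^ 2 ∂areaS2 < 4 * δ * ε :=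
    hw.radiation.eventually (gt_mem_nhds (by positivity))
  filter_upwards [hrad, eventually_ge_atTop R₀] with r h1 hr
  obtain ⟨c1, c2⟩ := continuous_restrict_sphere hw.contDiffOn (hR₀.le.trans hr)
    fun x hx => (hext x hx).trans_le hr
  have i1 : Integrable (fun θ : S2 => ‖w (r • (θ : E3))‖ ^ 2) areaS2 :=
    (c1.norm.pow 2).integrable_areaS2
  have i2 : Integrable (fun θ : S2 => ‖fderiv ℝ w (r • (θ : E3)) (θ : E3)
      - Complex.I * k * w (r • (θ : E3))‖ ^ 2) areaS2 :=
    ((c2.sub (continuous_const.mul c1)).norm.pow 2).integrable_areaS2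
  have i3 : Integrable (fun θ : S2 =>
      (fderiv ℝ w (r • (θ : E3)) (θ : E3) * star (w (r • (θ : E3)))).im) areaS2 :=
    (Complex.continuous_im.comp (c2.mul c1.star)).integrable_areaS2
  have key := integral_mono ((i1.const_mul (k - δ)).sub (i2.const_mul (4 * δ)⁻¹)) i3
    fun θ => le_im_mul_star (fderiv ℝ w (r • (θ : E3)) (θ : E3)) (w (r • (θ : E3))) k hδ
  simp only [Pi.sub_apply] at key
  rw [integral_sub (i1.const_mul _) (i2.const_mul _), integral_const_mul, integral_const_mul] at key
  have h2 := mul_le_mul_of_nonneg_left key (sq_nonneg r)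
  have h3 := mul_lt_mul_of_pos_left h1 (by positivity : (0 : ℝ) < (4 * δ)⁻¹)
  rw [mul_assoc 4 δ ε, ← mul_assoc 4 δ ε, inv_mul_cancel_left₀ (by positivity)] at h3
  rw [sphereFlux]
  refine le_trans ?_ h2
  rw [mul_sub]
  linarith

theorem IsWeakRadiatingField.im_integral_nonneg (hw : IsWeakRadiatingField Ω k w w₀ h)
    (hk : 0 < k) : 0 ≤ (∫ x : Ω.Boundary, h x * star (w₀ x) ∂Ω.surfaceMeasure).im := by
  refine le_of_forall_pos_le_add fun ε hε => ?_
  -- With `δ = k` the `|w|²` term disappears.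
  have := hw.le_im_integral (c := -ε) ((hw.le_sphereFlux hk hε).mono fun r hr => by simpa using hr)
  linarith

theorem IsWeakRadiatingField.mul_le_im_integral (hw : IsWeakRadiatingField Ω k w w₀ h)
    {m : ℝ}
    (hm : Tendsto (fun r : ℝ => r ^ 2 * ∫ θ : S2, ‖w (r • (θ : E3))‖ ^ 2 ∂areaS2) atTop (𝓝 m)) :
    k * m ≤ (∫ x : Ω.Boundary, h x * star (w₀ x) ∂Ω.surfaceMeasure).im := by
  have hδ : ∀ δ : ℝ, 0 < δ →
      (k - δ) * m ≤ (∫ x : Ω.Boundary, h x * star (w₀ x) ∂Ω.surfaceMeasure).im := by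
    intro δ hδ
    refine le_of_forall_pos_le_add fun ε hε => ?_
    have h1 := (hm.const_mul (k - δ)).eventually (lt_mem_nhds (sub_lt_self _ (half_pos hε)))
    have := hw.le_im_integral (c := (k - δ) * m - ε) (by
      filter_upwards [h1, hw.le_sphereFlux hδ (half_pos hε)] with r h2 h3
      linarith)
    linarith
  have hlim : Tendsto (fun δ : ℝ => (k - δ) * m) (𝓝[>] 0) (𝓝 (k * m)) := by
    have : Tendsto (fun δ : ℝ => (k - δ) * m) (𝓝 0) (𝓝 ((k - 0) * m)) :=
      ((continuous_const.sub continuous_id).mul continuous_const).tendsto 0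
    rw [sub_zero] at this
    exact this.mono_left nhdsWithin_le_nhds
  exact le_of_tendsto hlim (eventually_nhdsWithin_of_forall hδ)

/-! ### The scattering amplitude -/

theorem IsScatteringAmplitude.sub {u u₁ : E3 → ℂ} {uinf uinf₁ : S2 → ℂ}
    (hu : IsScatteringAmplitude k u uinf) (hu₁ : IsScatteringAmplitude k u₁ uinf₁) :
    IsScatteringAmplitude k (u - u₁) (uinf - uinf₁) := by
  refine (Asymptotics.IsLittleO.sub hu hu₁).congr_left fun p => ?_
  simp only [Pi.sub_apply]
  ring

/-- Multiply the expansion by `r e^{-ikr}`, of modulus `r`; the filter `atTop ×ˢ ⊤` encodes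
uniformity in `θ`. -/
theorem IsScatteringAmplitude.tendstoUniformly {winf : S2 → ℂ}
    (hs : IsScatteringAmplitude k w winf) :
    TendstoUniformly (fun (r : ℝ) (θ : S2) =>
      r * Complex.exp (-(Complex.I * k * r)) * w (r • (θ : E3))) winf atTop := by
  rw [tendstoUniformly_iff_tendsto, uniformity_basis_dist.tendsto_right_iff]
  intro ε hε
  have h1 := hs.def (half_pos hε)
  filter_upwards [h1, tendsto_fst.eventually (eventually_gt_atTop (0 : ℝ))] with p hp hp0
  have hp0' : (p.1 : ℂ) ≠ 0 := by exact_mod_cast hp0.ne'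
  have hn : ‖(p.1 : ℂ) * Complex.exp (-(Complex.I * k * p.1))‖ = p.1 := by
    rw [norm_mul, Complex.norm_exp, Complex.norm_real, Real.norm_of_nonneg hp0.le]
    simp
  have he : winf p.2 - p.1 * Complex.exp (-(Complex.I * k * p.1)) * w (p.1 • (p.2 : E3)) =
      -(p.1 * Complex.exp (-(Complex.I * k * p.1)) * (w (p.1 • (p.2 : E3))
        - Complex.exp (Complex.I * k * p.1) / p.1 * winf p.2)) := by
    rw [Complex.exp_neg]
    field_simp [Complex.exp_ne_zero]
    ring
  change dist (winf p.2) _ < ε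
  rw [dist_eq_norm, he, norm_neg, norm_mul, hn]
  rw [Real.norm_of_nonneg (by positivity : 0 ≤ 1 / p.1)] at hp
  have := mul_le_mul_of_nonneg_left hp hp0.le
  have e : p.1 * (ε / 2 * (1 / p.1)) = ε / 2 := by field_simp
  rw [e] at this
  linarith

/-- A uniform limit of continuous functions. This supplies the measurability and boundedness not
assumed of the amplitude. -/
theorem IsScatteringAmplitude.continuous {winf : S2 → ℂ} (hw : ContDiffOn ℝ 2 w Ω.exterior)
    (hs : IsScatteringAmplitude k w winf) : Continuous winf := by
  obtain ⟨R₀, hR₀, hext⟩ := Ω.exists_radius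
  refine hs.tendstoUniformly.continuous (Eventually.frequently ?_)
  filter_upwards [eventually_ge_atTop R₀] with r hr
  exact continuous_const.mul (continuous_restrict_sphere hw (hR₀.le.trans hr)
    fun x hx => (hext x hx).trans_le hr).1

theorem IsScatteringAmplitude.tendsto_integral {winf : S2 → ℂ}
    (hw : ContDiffOn ℝ 2 w Ω.exterior) (hs : IsScatteringAmplitude k w winf) :
    Tendsto (fun r : ℝ => r ^ 2 * ∫ θ : S2, ‖w (r • (θ : E3))‖ ^ 2 ∂areaS2) atTop
      (𝓝 (∫ θ, ‖winf θ‖ ^ 2 ∂areaS2)) := by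
  obtain ⟨R₀, hR₀, hext⟩ := Ω.exists_radius
  have hu := hs.tendstoUniformly
  obtain ⟨C, hC⟩ := isCompact_univ.exists_bound_of_continuousOn (hs.continuous hw).continuousOn
  have hn : ∀ (r : ℝ) (θ : S2), ‖r * Complex.exp (-(Complex.I * k * r)) * w (r • (θ : E3))‖ ^ 2 =
      r ^ 2 * ‖w (r • (θ : E3))‖ ^ 2 := by
    intro r θ
    rw [norm_mul, norm_mul, Complex.norm_exp, Complex.norm_real, mul_pow, mul_pow]
    simp
  simp_rw [← integral_const_mul, ← hn]
  -- `C` bounds the amplitude, and uniform convergence eventually adds at most 1.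
  refine tendsto_integral_filter_of_dominated_convergence (fun _ => (C + 1) ^ 2) ?_ ?_
    (integrable_const _) (Eventually.of_forall fun θ => ((hu.tendsto_at θ).norm.pow 2))
  · filter_upwards [eventually_ge_atTop R₀] with r hr
    exact ((continuous_const.mul (continuous_restrict_sphere hw (hR₀.le.trans hr)
      fun x hx => (hext x hx).trans_le hr).1).norm.pow 2).aestronglyMeasurable
  · filter_upwards [Metric.tendstoUniformly_iff.1 hu 1 one_pos] with r hr
    refine Eventually.of_forall fun θ => ?_
    have h1 := hr θ
    rw [dist_comm, dist_eq_norm] at h1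
    have h2 := norm_le_norm_add_norm_sub (winf θ)
      (r * Complex.exp (-(Complex.I * k * r)) * w (r • (θ : E3)))
    rw [norm_sub_rev] at h2
    have h3 := hC θ (mem_univ _)
    rw [Real.norm_of_nonneg (by positivity)]
    refine pow_le_pow_left₀ (norm_nonneg _) ?_ 2
    linarith [norm_sub_rev (winf θ) (r * Complex.exp (-(Complex.I * k * r)) * w (r • (θ : E3)))]

/-! ### The impedance boundary condition -/

theorem integral_norm_sq_eq_norm_sq (w₀ : Ω.L2Boundary) :
    Integrable (fun x => ‖w₀ x‖ ^ 2) Ω.surfaceMeasure ∧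
      ∫ x, ‖w₀ x‖ ^ 2 ∂Ω.surfaceMeasure = ‖w₀‖ ^ 2 := by
  refine ⟨(Lp.memLp w₀).integrable_norm_pow (by norm_num), ?_⟩
  have h1 := congrArg Complex.re (inner_self_eq_norm_sq_to_K (𝕜 := ℂ) w₀)
  have h2 : (inner ℂ w₀ w₀ : ℂ) = ((∫ x, ‖w₀ x‖ ^ 2 ∂Ω.surfaceMeasure : ℝ) : ℂ) := by
    rw [L2.inner_def, ← integral_complex_ofReal]
    refine integral_congr_ae (Eventually.of_forall fun x => ?_)
    simp
  rw [h2, Complex.ofReal_re] at h1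
  rw [h1, ← RCLike.ofReal_pow]
  exact Complex.ofReal_re _

/-- Boundary part of the energy estimate, for `h + γ w₀ = -α`. -/
theorem mul_norm_sq_add_im_integral_le {γ : C(Ω.Boundary, ℂ)} {γ₀ : ℝ}
    (hγ : ∀ x, γ₀ ≤ (γ x).im) {α : Ω.L2Boundary}
    (hbc : ∀ᵐ x ∂Ω.surfaceMeasure, h x = -α x - γ x * w₀ x) :
    γ₀ * ‖w₀‖ ^ 2 + (∫ x, h x * star (w₀ x) ∂Ω.surfaceMeasure).im ≤ ‖α‖ * ‖w₀‖ := by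
  obtain ⟨i1, e1⟩ := integral_norm_sq_eq_norm_sq w₀
  have i2 := (Lp.memLp h).integrable_mul_star (Lp.memLp w₀)
  have i3 := (Lp.memLp α).integrable_mul_star (Lp.memLp w₀)
  have h3 : ∫ x, α x * star (w₀ x) ∂Ω.surfaceMeasure = inner ℂ w₀ α := by
    rw [L2.inner_def]
    refine integral_congr_ae (Eventually.of_forall fun x => ?_)
    simp
  have e2 := integral_im i2
  have e3 := integral_im i3
  have key : ∫ x, γ₀ * ‖w₀ x‖ ^ 2 ∂Ω.surfaceMeasure ≤
      ∫ x, (-(RCLike.im (α x * star (w₀ x))) - RCLike.im (h x * star (w₀ x)))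
        ∂Ω.surfaceMeasure := by
    refine integral_mono_ae (i1.const_mul _) (i3.im.neg.sub i2.im) (hbc.mono fun x hx => ?_)
    -- Pairing the boundary condition with `w̄₀` gives `γ |w₀|²`, whose imaginary part is at least
    -- `γ₀ |w₀|²`.
    have e : h x * star (w₀ x) = -(α x * star (w₀ x)) - γ x * ((‖w₀ x‖ ^ 2 : ℝ) : ℂ) := by
      rw [hx, ← Complex.normSq_eq_norm_sq, ← Complex.mul_conj, starRingEnd_apply]
      ring
    simp only [RCLike.im_to_complex, e, Complex.sub_im, Complex.neg_im, Complex.im_mul_ofReal]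
    nlinarith [mul_le_mul_of_nonneg_right (hγ x) (sq_nonneg ‖w₀ x‖)]
  rw [integral_const_mul, e1, integral_sub (f := fun x => -RCLike.im (α x * star (w₀ x))) i3.im.neg i2.im, integral_neg,
    e2, e3, h3] at key
  have h4 := (Complex.abs_im_le_norm (inner ℂ w₀ α : ℂ)).trans (norm_inner_le_norm w₀ α)
  have h5 := (abs_le.1 h4).1
  simp only [RCLike.im_to_complex] at key
  linarith [mul_comm ‖α‖ ‖w₀‖]

theorem norm_le_of_impedance {γ : C(Ω.Boundary, ℂ)} {α : Ω.L2Boundary}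
    (hbc : ∀ᵐ x ∂Ω.surfaceMeasure, h x = -α x - γ x * w₀ x) :
    ‖h‖ ≤ ‖α‖ + ‖γ‖ * ‖w₀‖ := by
  have h1 : ‖h + α‖ ≤ ‖γ‖ * ‖w₀‖ := by
    refine Lp.norm_le_mul_norm_of_ae_le_mul ?_
    filter_upwards [hbc, Lp.coeFn_add h α] with x hx hx'
    rw [hx', Pi.add_apply, hx, show -α x - γ x * w₀ x + α x = -(γ x * w₀ x) by ring, norm_neg,
      norm_mul]
    exact mul_le_mul_of_nonneg_right (γ.norm_coe_le_norm x) (norm_nonneg _)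
  have h2 := norm_sub_le (h + α) α
  rw [add_sub_cancel_right] at h2
  linarith

end Flux

/-- `u` is the exact and `u₁` the approximate radiating field; `u₀, g` and `u₁₀, g₁` are their
boundary values and normal derivatives on `∂Ω`, and `‖γ‖` is the maximum norm of `γ` on `∂Ω`. -/
theorem theorem2 (Ω : SmoothBody) (k : ℝ) (hk : 0 < k)
    (γ f : C(Ω.Boundary, ℂ)) (γ₀ : ℝ) (hγ₀ : 0 < γ₀) (hγ : ∀ x, γ₀ ≤ (γ x).im)
    (α : Ω.L2Boundary)
    (u : E3 → ℂ) (u₀ g : Ω.L2Boundary) (hu : IsRadiatingField Ω k u u₀ g)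
    (hbc : ∀ᵐ x ∂Ω.surfaceMeasure, g x + γ x * u₀ x = f x)
    (u₁ : E3 → ℂ) (u₁₀ g₁ : Ω.L2Boundary) (hu₁ : IsRadiatingField Ω k u₁ u₁₀ g₁)
    (hbc₁ : ∀ᵐ x ∂Ω.surfaceMeasure, g₁ x + γ x * u₁₀ x = f x + α x) :
    ‖u₀ - u₁₀‖ ≤ 1 / γ₀ * ‖α‖ ∧
    ‖g - g₁‖ ≤ (‖γ‖ / γ₀ + 1) * ‖α‖ ∧
    ∀ uinf uinf₁ : S2 → ℂ,
      IsScatteringAmplitude k u uinf → IsScatteringAmplitude k u₁ uinf₁ →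
        MemLp (uinf - uinf₁) 2 areaS2 ∧
        ∫ θ, ‖uinf θ - uinf₁ θ‖ ^ 2 ∂areaS2 ≤
          1 / (k * γ₀) * (‖γ‖ / γ₀ + 1) * ‖α‖ ^ 2 := by
  have hw := hu.sub hu₁
  have hbw : ∀ᵐ x ∂Ω.surfaceMeasure, (g - g₁) x = -α x - γ x * (u₀ - u₁₀) x := by
    filter_upwards [hbc, hbc₁, Lp.coeFn_sub g g₁, Lp.coeFn_sub u₀ u₁₀] with x h1 h2 h3 h4
    rw [h3, h4, Pi.sub_apply, Pi.sub_apply]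
    linear_combination h1 - h2
  have hE := mul_norm_sq_add_im_integral_le hγ hbw
  have hI := hw.im_integral_nonneg hk
  have h1 : ‖u₀ - u₁₀‖ ≤ 1 / γ₀ * ‖α‖ := by
    rw [one_div, ← div_eq_inv_mul, le_div_iff₀ hγ₀]
    by_contra! hlt
    have hpos : 0 < ‖u₀ - u₁₀‖ := by
      rcases (norm_nonneg (u₀ - u₁₀)).eq_or_lt with h0 | h0
      · rw [← h0, zero_mul] at hlt
        exact absurd hlt (norm_nonneg α).not_gt
      · exact h0
    -- Without the nonnegative flux, `hE` reads `γ₀ ‖w₀‖² ≤ ‖α‖ ‖w₀‖`, which contradicts `hlt`.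
    nlinarith [mul_lt_mul_of_pos_right hlt hpos]
  refine ⟨h1, ?_, fun uinf uinf₁ hs hs₁ => ?_⟩
  · have h2 := norm_le_of_impedance hbw
    have h3 := mul_le_mul_of_nonneg_left h1 (norm_nonneg γ)
    calc _ ≤ ‖α‖ + ‖γ‖ * (1 / γ₀ * ‖α‖) := by linarith
      _ = _ := by ring
  · have hs' := hs.sub hs₁
    have hc := hs'.continuous hw.contDiffOn
    refine ⟨hc.memLp_of_hasCompactSupport (HasCompactSupport.of_compactSpace _), ?_⟩
    have h2 := hw.mul_le_im_integral (hs'.tendsto_integral hw.contDiffOn)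
    simp only [Pi.sub_apply] at h2
    have h3 : k * ∫ θ, ‖uinf θ - uinf₁ θ‖ ^ 2 ∂areaS2 ≤ 1 / γ₀ * ‖α‖ ^ 2 := by
      -- The chain is `k ‖w_∞‖² ≤ flux ≤ ‖α‖ ‖w₀‖ ≤ ‖α‖² / γ₀`.
      have h4 := mul_le_mul_of_nonneg_left h1 (norm_nonneg α)
      have h5 : 0 ≤ γ₀ * ‖u₀ - u₁₀‖ ^ 2 := by positivity
      nlinarith
    calc _ = 1 / k * (k * ∫ θ, ‖uinf θ - uinf₁ θ‖ ^ 2 ∂areaS2) := by field_simp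
      _ ≤ 1 / k * (1 / γ₀ * ‖α‖ ^ 2) := by gcongr
      _ = 1 / (k * γ₀) * 1 * ‖α‖ ^ 2 := by field_simp
      -- The stated factor `‖γ‖ / γ₀ + 1 ≥ 1` is simply given away.
      _ ≤ _ := by
        gcongr
        exact le_add_of_nonneg_left (by positivity)
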